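/- Let $X$ be one of the Riemann surfaces $\mathbb{P}^1(\mathbb{C})$ (the Riemann sphere), $\mathbb{C}$, or $\mathbb{H}$ (the open upper half-plane), and let $\mathrm{Aut}(X)$ be the group of biholomorphic maps $X\to X$. A (cocompact) fuchsian group is a group isomorphic to a finitely generated subgroup $\Gamma$ of $\mathrm{Aut}(X)$, for one of these three $X$, such that $\Gamma$ acts properly discontinuously on $X$ and the quotient $X/\Gamma$ is compact. Every (cocompact) fuchsian group $G$ has a torsion-free normal subgroup of finite index; that is, there is a normal subgroup $N$ of finite index in $G$ such that the identity is the only element of $N$ of finite order. -/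

import Mathlib

open Filter Topology Manifold ContDiff

/-! ### The Riemann sphere `ℙ¹(ℂ) = ℂ ∪ {∞}` as a Riemann surface -/

namespace RiemannSphere

open scoped Classical in
/-- The inversion `z ↦ 1 / z` of `ℂ ∪ {∞}`, exchanging `0` and `∞`. -/
noncomputable def inversion : OnePoint ℂ → OnePoint ℂ
  | OnePoint.infty => ((0 : ℂ) : OnePoint ℂ)
  | OnePoint.some z => if z = 0 then OnePoint.infty else ((z⁻¹ : ℂ) : OnePoint ℂ)

theorem inversion_infty : inversion OnePoint.infty = ((0 : ℂ) : OnePoint ℂ) := rfl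

theorem inversion_zero : inversion ((0 : ℂ) : OnePoint ℂ) = OnePoint.infty := if_pos rfl

theorem inversion_coe {z : ℂ} (hz : z ≠ 0) :
    inversion (z : OnePoint ℂ) = ((z⁻¹ : ℂ) : OnePoint ℂ) := if_neg hz

theorem inversion_inversion (x : OnePoint ℂ) : inversion (inversion x) = x := by
  induction x using OnePoint.rec with
  | infty => rw [inversion_infty, inversion_zero]
  | coe z =>
    by_cases hz : z = 0
    · subst hz; rw [inversion_zero, inversion_infty]
    · rw [inversion_coe hz, inversion_coe (inv_ne_zero hz), inv_inv]

theorem continuous_inversion : Continuous inversion := by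
  rw [continuous_iff_continuousAt]
  intro x
  induction x using OnePoint.rec with
  | infty =>
    rw [OnePoint.continuousAt_infty', inversion_infty, coclosedCompact_eq_cocompact]
    have h : Tendsto (fun z : ℂ => ((z⁻¹ : ℂ) : OnePoint ℂ)) (cocompact ℂ)
        (𝓝 ((0 : ℂ) : OnePoint ℂ)) := by
      rw [← Metric.cobounded_eq_cocompact]
      exact (OnePoint.continuous_coe.tendsto (0 : ℂ)).comp tendsto_inv₀_cobounded
    refine h.congr' ?_
    have h0 : ∀ᶠ z : ℂ in cocompact ℂ, z ≠ 0 :=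
      isCompact_singleton.compl_mem_cocompact
    filter_upwards [h0] with z hz
    exact (inversion_coe hz).symm
  | coe z =>
    rw [OnePoint.continuousAt_coe]
    by_cases hz : z = 0
    · subst hz
      rw [continuousAt_iff_punctured_nhds, Function.comp_apply, inversion_zero]
      have h : Tendsto (fun z : ℂ => ((z⁻¹ : ℂ) : OnePoint ℂ)) (𝓝[≠] 0)
          (𝓝 OnePoint.infty) := by
        refine (OnePoint.tendsto_coe_infty (X := ℂ)).comp ?_
        rw [coclosedCompact_eq_cocompact, ← Metric.cobounded_eq_cocompact]
        exact tendsto_inv₀_nhdsNE_zero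
      refine h.congr' ?_
      filter_upwards [self_mem_nhdsWithin] with w hw
      exact (inversion_coe hw).symm
    · have h : ContinuousAt (fun w : ℂ => ((w⁻¹ : ℂ) : OnePoint ℂ)) z :=
        OnePoint.continuous_coe.continuousAt.comp (continuousAt_inv₀ hz)
      refine h.congr ?_
      filter_upwards [isOpen_ne.mem_nhds hz] with w hw
      exact (inversion_coe hw).symm

/-- The inversion `z ↦ 1 / z` as a homeomorphism of the sphere. -/
noncomputable def inversionHomeomorph : OnePoint ℂ ≃ₜ OnePoint ℂ where
  toFun := inversion
  invFun := inversion
  left_inv := inversion_inversion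
  right_inv := inversion_inversion
  continuous_toFun := continuous_inversion
  continuous_invFun := continuous_inversion

/-- The chart `z ↦ z` of the sphere, with domain `ℂ`. -/
noncomputable def chartZero : OpenPartialHomeomorph (OnePoint ℂ) ℂ :=
  ((OnePoint.isOpenEmbedding_coe (X := ℂ)).toOpenPartialHomeomorph _).symm

/-- The chart `z ↦ 1 / z` of the sphere, with domain the complement of `0`. -/
noncomputable def chartInfty : OpenPartialHomeomorph (OnePoint ℂ) ℂ :=
  inversionHomeomorph.toOpenPartialHomeomorph.trans chartZero

theorem mem_chartZero_source (z : ℂ) : (z : OnePoint ℂ) ∈ chartZero.source := by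
  simp [chartZero]

theorem infty_mem_chartInfty_source : OnePoint.infty ∈ chartInfty.source := by
  simp only [chartInfty, OpenPartialHomeomorph.trans_source]
  exact ⟨trivial, mem_chartZero_source 0⟩

open scoped Classical in
/-- The standard complex atlas of the Riemann sphere: the charts `z` and `1 / z`. -/
noncomputable instance : ChartedSpace ℂ (OnePoint ℂ) where
  atlas := {chartZero, chartInfty}
  chartAt x := if x = OnePoint.infty then chartInfty else chartZero
  mem_chart_source x := by
    induction x using OnePoint.rec with
    | infty => rw [if_pos rfl]; exact infty_mem_chartInfty_source
    | coe z => rw [if_neg (OnePoint.coe_ne_infty z)]; exact mem_chartZero_source z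
  chart_mem_atlas x := by
    split_ifs
    · exact Set.mem_insert_of_mem _ rfl
    · exact Set.mem_insert _ _

theorem transition_apply {z : ℂ} (hz : z ≠ 0) :
    (chartZero.symm.trans chartInfty) z = z⁻¹ := by
  change chartZero (inversion (z : OnePoint ℂ)) = _
  rw [inversion_coe hz]
  exact chartZero.right_inv (x := z⁻¹) trivial

/-- The two charts are holomorphically compatible. -/
instance : IsManifold 𝓘(ℂ) ω (OnePoint ℂ) := by
  have key : (chartZero.symm.trans chartInfty).source = {0}ᶜ := by
    ext z
    have : z ∈ (chartZero.symm.trans chartInfty).source ↔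
        inversion (z : OnePoint ℂ) ∈ chartZero.source := by
      simp only [OpenPartialHomeomorph.trans_source, chartInfty]
      constructor
      · rintro ⟨_, _, h⟩; exact h
      · intro h; exact ⟨trivial, trivial, h⟩
    rw [this]
    by_cases hz : z = 0
    · subst hz; simp [inversion_zero, chartZero]
    · rw [inversion_coe hz]; simp [hz, mem_chartZero_source]
  have sym : (chartInfty.symm.trans chartZero) = (chartZero.symm.trans chartInfty) := by
    have h : inversionHomeomorph.symm = inversionHomeomorph := rfl
    rw [chartInfty, OpenPartialHomeomorph.trans_symm_eq_symm_trans_symm,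
      OpenPartialHomeomorph.trans_assoc]
    rfl
  have hd : ContDiffOn ℂ ω (chartZero.symm.trans chartInfty)
      (chartZero.symm.trans chartInfty).source := by
    rw [key]
    refine ContDiffOn.congr (f := fun z => z⁻¹) ?_ (fun z hz => transition_apply hz)
    exact fun z hz => (contDiffAt_inv ℂ hz).contDiffWithinAt
  apply isManifold_of_contDiffOn
  intro e e' he he'
  simp only [modelWithCornersSelf_coe, modelWithCornersSelf_coe_symm, Function.comp_id,
    Function.id_comp, Set.range_id, Set.inter_univ, Set.preimage_id]
  have self : ∀ e : OpenPartialHomeomorph (OnePoint ℂ) ℂ, ContDiffOn ℂ ω (e.symm.trans e)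
      (e.symm.trans e).source := by
    intro e
    refine ContDiffOn.congr contDiffOn_id (fun z hz => ?_)
    exact e.right_inv (by simpa using hz.1)
  rcases he with rfl | rfl <;> rcases he' with rfl | rfl
  · exact self _
  · exact hd
  · rw [sym]; exact hd
  · exact self _

end RiemannSphere

/-! ### Fuchsian groups -/

/-- `Aut X`, the group of biholomorphic self-maps of the Riemann surface `X`. -/
def holomorphicAut (X : Type*) [TopologicalSpace X] [ChartedSpace ℂ X] :
    Subgroup (Equiv.Perm X) where
  carrier := {f | MDifferentiable 𝓘(ℂ) 𝓘(ℂ) (f : X → X) ∧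
    MDifferentiable 𝓘(ℂ) 𝓘(ℂ) (f.symm : X → X)}
  one_mem' := ⟨mdifferentiable_id, mdifferentiable_id⟩
  mul_mem' hf hg := ⟨hf.1.comp hg.1, hg.2.comp hf.2⟩
  inv_mem' hf := ⟨hf.2, hf.1⟩

/-- `Γ` is a finitely generated group of biholomorphic self-maps of `X` which acts properly
discontinuously on `X` and whose quotient `X / Γ` is compact. -/
structure IsCocompactDiscontinuous {X : Type*} [TopologicalSpace X] [ChartedSpace ℂ X]
    (Γ : Subgroup (Equiv.Perm X)) : Prop where
  le_aut : Γ ≤ holomorphicAut X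
  fg : Γ.FG
  properlyDiscontinuous : ProperlyDiscontinuousSMul Γ X
  compact_quotient : CompactSpace (MulAction.orbitRel.Quotient Γ X)

/-- A (cocompact) fuchsian group: a group isomorphic to a finitely generated, properly
discontinuous group of automorphisms, with compact quotient, of one of the simply connected
Riemann surfaces `ℙ¹(ℂ)`, `ℂ` and `ℍ`. -/
def IsFuchsianGroup (G : Type*) [Group G] : Prop :=
  (∃ Γ : Subgroup (Equiv.Perm (OnePoint ℂ)), IsCocompactDiscontinuous Γ ∧ Nonempty (G ≃* Γ)) ∨
  (∃ Γ : Subgroup (Equiv.Perm ℂ), IsCocompactDiscontinuous Γ ∧ Nonempty (G ≃* Γ)) ∨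
  (∃ Γ : Subgroup (Equiv.Perm UpperHalfPlane),
    IsCocompactDiscontinuous Γ ∧ Nonempty (G ≃* Γ))

/-- `N` is torsion-free: the only element of `N` of finite order is the identity. -/
def IsTorsionFreeSubgroup {G : Type*} [Group G] (N : Subgroup G) : Prop :=
  ∀ x ∈ N, IsOfFinOrder x → x = 1

/-!
Automorphisms of the plane, the sphere and the half-plane are Möbius transformations: in the plane
they grow at most linearly, on the sphere one may move the image of `∞` back to `∞` and restrict to
the plane, and on the half-plane the Schwarz lemma applies to the conjugate by Cayley transforms. A
Möbius transformation is determined up to scalars by its values on an infinite set, so `G` embeds in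
`PGL₂(ℂ)`, and this group is linear because it acts faithfully on matrices by conjugation.

The entries of generators of a linear group and of their inverses generate a ring whose residue
fields at maximal ideals are finite. A congruence subgroup at a maximal ideal of residue
characteristic `p` has no torsion of order prime to `p`; the intersection of two of them with
distinct residue characteristics is torsion-free.
-/

/-- A group is virtually torsion-free if it has a torsion-free normal subgroup of finite index. -/
def IsVirtuallyTorsionFree (G : Type*) [Group G] : Prop :=
  ∃ N : Subgroup G, N.Normal ∧ N.FiniteIndex ∧ IsTorsionFreeSubgroup N

theorem IsVirtuallyTorsionFree.of_injective {G H : Type*} [Group G] [Group H]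
    (hH : IsVirtuallyTorsionFree H) {f : G →* H} (hf : Function.Injective f) :
    IsVirtuallyTorsionFree G := by
  obtain ⟨N, hN, hfin, htf⟩ := hH
  have := (FiniteIndexNormalSubgroup.ofSubgroup N).comap f |>.isFiniteIndex'
  refine ⟨N.comap f, inferInstance, this, fun x hx hord => ?_⟩
  exact (map_eq_one_iff f hf).1 (htf (f x) hx (f.isOfFinOrder hord))

theorem isTorsionFreeSubgroup_of_forall_prime {G : Type*} [Group G] {N : Subgroup G}
    (h : ∀ x ∈ N, ∀ q : ℕ, q.Prime → x ^ q = 1 → x = 1) : IsTorsionFreeSubgroup N := by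
  intro x hx hfin
  by_contra hne
  set q := (orderOf x).minFac
  have hq : q.Prime := Nat.minFac_prime (by rwa [Ne, orderOf_eq_one_iff])
  have hord : orderOf (x ^ (orderOf x / q)) = q :=
    orderOf_pow_orderOf_div hfin.orderOf_pos.ne' (Nat.minFac_dvd _)
  have hone : x ^ (orderOf x / q) = 1 :=
    h _ (pow_mem hx _) q hq (orderOf_dvd_iff_pow_eq_one.1 hord.dvd)
  exact hq.one_lt.ne (by rw [← hord, hone, orderOf_one])

section FiniteResidueRings

theorem isJacobsonRing_int : IsJacobsonRing ℤ := by
  rw [isJacobsonRing_iff_prime_eq]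
  intro P hP
  by_cases hbot : P = ⊥
  · subst hbot
    refine le_antisymm (fun x hx => ?_) Ideal.le_jacobson
    rw [Ideal.mem_jacobson_bot] at hx
    by_contra hx0
    have hpos : 0 < x * x := mul_self_pos.2 hx0
    -- `1 + 3 x ^ 2` is greater than one, hence not a unit.
    have hunit : IsUnit (x * (3 * x) + 1) := hx (3 * x)
    rcases Int.isUnit_iff.1 hunit with h | h <;> nlinarith
  · have := hP.isMaximal hbot
    exact Ideal.jacobson_eq_self_of_isMaximal

theorem finite_of_finiteType_int (k : Type*) [Field k] [Algebra.FiniteType ℤ k] : Finite k := by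
  have := isJacobsonRing_int
  have hfin : Module.Finite ℤ k := finite_of_finite_type_of_isJacobsonRing ℤ k
  obtain ⟨p, hp⟩ := CharP.exists k
  rcases CharP.char_is_prime_or_zero k p with hprime | rfl
  · have : Fact p.Prime := ⟨hprime⟩
    let _ := ZMod.algebra k p
    have : IsScalarTower ℤ (ZMod p) k := IsScalarTower.of_algebraMap_eq' (RingHom.ext_int _ _)
    have : Module.Finite (ZMod p) k := Module.Finite.of_restrictScalars_finite ℤ (ZMod p) k
    exact Module.finite_of_finite (ZMod p)
  · have : CharZero k := CharP.charP_to_charZero k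
    -- An integral extension of `ℤ` cannot be a field, since `ℤ` is not.
    exact absurd (isField_of_isIntegral_of_isField (FaithfulSMul.algebraMap_injective ℤ k)
      (Field.toIsField k)) Int.not_isField

variable {A : Type*} [CommRing A] [IsDomain A] [Algebra.FiniteType ℤ A]

theorem exists_isMaximal_finite_quotient_notMem {a : A} (ha : a ≠ 0) :
    ∃ m : Ideal A, m.IsMaximal ∧ Finite (A ⧸ m) ∧ a ∉ m := by
  have := isJacobsonRing_int
  have hA : IsJacobsonRing A := isJacobsonRing_of_finiteType (A := ℤ)
  have hbot : a ∉ (⊥ : Ideal A).jacobson := by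
    rwa [isJacobsonRing_iff_prime_eq.1 hA ⊥ Ideal.isPrime_bot, Ideal.mem_bot]
  simp only [Ideal.jacobson, Ideal.mem_sInf, not_forall] at hbot
  obtain ⟨m, ⟨-, hm⟩, ham⟩ := hbot
  have hft : Algebra.FiniteType ℤ (A ⧸ m) :=
    Algebra.FiniteType.of_surjective (Ideal.Quotient.mkₐ ℤ m) (Ideal.Quotient.mkₐ_surjective ℤ m)
  exact ⟨m, hm, @finite_of_finiteType_int (A ⧸ m) (Ideal.Quotient.field m) hft, ham⟩

theorem exists_isMaximal_pair_forall_prime_notMem (A : Type*) [CommRing A] [IsDomain A]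
    [CharZero A] [Algebra.FiniteType ℤ A] :
    ∃ m₁ m₂ : Ideal A, m₁.IsMaximal ∧ Finite (A ⧸ m₁) ∧ m₂.IsMaximal ∧ Finite (A ⧸ m₂) ∧
      ∀ q : ℕ, q.Prime → (q : A) ∉ m₁ ∨ (q : A) ∉ m₂ := by
  obtain ⟨m₁, hm₁, hfin₁, -⟩ := exists_isMaximal_finite_quotient_notMem (one_ne_zero (α := A))
  set c := Nat.card (A ⧸ m₁)
  have hc : (c : A) ∈ m₁ := by
    rw [← Ideal.Quotient.eq_zero_iff_mem, map_natCast, ← nsmul_one]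
    exact card_nsmul_eq_zero'
  obtain ⟨m₂, hm₂, hfin₂, hcm₂⟩ := exists_isMaximal_finite_quotient_notMem
    (Nat.cast_ne_zero (R := A).2 (Nat.card_pos (α := A ⧸ m₁)).ne')
  refine ⟨m₁, m₂, hm₁, hfin₁, hm₂, hfin₂, fun q hq => ?_⟩
  by_contra! ⟨hq₁, hq₂⟩
  rcases Nat.coprime_or_dvd_of_prime hq c with hcop | hdvd
  · obtain ⟨u, v, huv⟩ := hcop.cast (R := A)
    exact hm₁.ne_top ((Ideal.eq_top_iff_one _).2
      (huv ▸ add_mem (m₁.mul_mem_left u hq₁) (m₁.mul_mem_left v hc)))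
  · exact hcm₂ (m₂.mem_of_dvd (Nat.cast_dvd_cast hdvd) hq₂)

end FiniteResidueRings

section Congruence

open Matrix

variable {n A : Type*} [Fintype n] [DecidableEq n] [CommRing A]

/-- The principal congruence subgroup of level `I` in `GL n A`: the matrices congruent to the
identity modulo `I`. -/
def congruenceSubgroup (n : Type*) [Fintype n] [DecidableEq n] (I : Ideal A) :
    Subgroup (GL n A) :=
  (GeneralLinearGroup.map (Ideal.Quotient.mk I)).ker

instance (I : Ideal A) : (congruenceSubgroup n I).Normal := MonoidHom.normal_ker _

theorem mem_congruenceSubgroup {I : Ideal A} {g : GL n A} :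
    g ∈ congruenceSubgroup n I ↔ (Ideal.Quotient.mk I).mapMatrix g.val = 1 := by
  rw [congruenceSubgroup, MonoidHom.mem_ker, Units.ext_iff]
  rfl

theorem finiteIndex_congruenceSubgroup (I : Ideal A) [Finite (A ⧸ I)] :
    (congruenceSubgroup n I).FiniteIndex := by
  have : Finite (Matrix n n (A ⧸ I)) := inferInstanceAs (Finite (n → n → A ⧸ I))
  exact inferInstanceAs (GeneralLinearGroup.map (Ideal.Quotient.mk I)).ker.FiniteIndex

variable [IsDomain A]

-- `M - 1` is killed by `1 + M + ⋯ + M ^ (k - 1)`, whose determinant is `k ^ n` modulo `I`.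
theorem eq_one_of_mapMatrix_eq_one_of_pow_eq_one {I : Ideal A} [I.IsPrime] {k : ℕ}
    (hk : (k : A) ∉ I) {M : Matrix n n A} (hM : (Ideal.Quotient.mk I).mapMatrix M = 1)
    (hpow : M ^ k = 1) : M = 1 := by
  set S := ∑ i ∈ Finset.range k, M ^ i
  have hS : (Ideal.Quotient.mk I).mapMatrix S = (k : Matrix n n (A ⧸ I)) := by
    simp only [S, map_sum, map_pow, hM, one_pow, Finset.sum_const, Finset.card_range, nsmul_one]
  have hdet : S.det ≠ 0 := by
    intro h0
    have hzero : (k : A ⧸ I) ^ Fintype.card n = 0 := by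
      rw [← map_zero (Ideal.Quotient.mk I), ← h0, RingHom.map_det, hS, ← diagonal_natCast,
        det_diagonal, Finset.prod_const, Finset.card_univ]
    apply hk
    rw [← Ideal.Quotient.eq_zero_iff_mem, map_natCast]
    exact eq_zero_of_pow_eq_zero hzero
  have hmul : S * (M - 1) = 0 := by rw [geom_sum_mul, hpow, sub_self]
  have hsmul : S.det • (M - 1) = 0 := by
    rw [← one_mul (M - 1), ← smul_mul_assoc, ← adjugate_mul, mul_assoc, hmul, mul_zero]
  exact sub_eq_zero.1 ((smul_eq_zero.1 hsmul).resolve_left hdet)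

theorem isVirtuallyTorsionFree_GL_of_finiteType_int [CharZero A] [Algebra.FiniteType ℤ A] :
    IsVirtuallyTorsionFree (GL n A) := by
  obtain ⟨m₁, m₂, hm₁, hfin₁, hm₂, hfin₂, hq⟩ := exists_isMaximal_pair_forall_prime_notMem A
  have := finiteIndex_congruenceSubgroup (n := n) m₁
  have := finiteIndex_congruenceSubgroup (n := n) m₂
  refine ⟨congruenceSubgroup n m₁ ⊓ congruenceSubgroup n m₂, inferInstance, inferInstance,
    isTorsionFreeSubgroup_of_forall_prime fun g hg q hprime hpow => Units.ext ?_⟩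
  have hpow' : g.val ^ q = 1 := congrArg Units.val hpow
  rcases hq q hprime with h | h
  · exact eq_one_of_mapMatrix_eq_one_of_pow_eq_one h (mem_congruenceSubgroup.1 hg.1) hpow'
  · exact eq_one_of_mapMatrix_eq_one_of_pow_eq_one h (mem_congruenceSubgroup.1 hg.2) hpow'

end Congruence

section Selberg

open Matrix

variable {G n : Type*} [Group G] [Group.FG G] [Fintype n] [DecidableEq n]

theorem mem_range_map_val {R B n : Type*} [Fintype n] [DecidableEq n] [CommRing R] [CommRing B]
    [Algebra R B] {A : Subalgebra R B} {g : GL n B} (hg : ∀ i j, g.val i j ∈ A)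
    (hg' : ∀ i j, g⁻¹.val i j ∈ A) :
    g ∈ (GeneralLinearGroup.map (n := n) (A.val : A →+* B)).range := by
  have hinj : Function.Injective ((A.val : A →+* B).mapMatrix (m := n)) :=
    Matrix.map_injective Subtype.val_injective
  refine ⟨⟨of fun i j => ⟨g.val i j, hg i j⟩, of fun i j => ⟨g⁻¹.val i j, hg' i j⟩,
    hinj ?_, hinj ?_⟩, Units.ext rfl⟩
  · rw [map_mul, map_one]
    exact g.mul_inv
  · rw [map_mul, map_one]
    exact g.inv_mul

theorem exists_finiteType_range_le_range_map {B : Type*} [CommRing B] (ρ : G →* GL n B) :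
    ∃ A : Subalgebra ℤ B, Algebra.FiniteType ℤ A ∧
      ρ.range ≤ (GeneralLinearGroup.map (n := n) (A.val : A →+* B)).range := by
  obtain ⟨S, hS⟩ := Group.FG.out (G := G)
  let E : Set B := ⋃ s ∈ S, ⋃ i : n, ⋃ j : n, {(ρ s).val i j, (ρ s)⁻¹.val i j}
  have hE : E.Finite := S.finite_toSet.biUnion fun s _ =>
    Set.finite_iUnion fun i => Set.finite_iUnion fun j => Set.toFinite _
  refine ⟨Algebra.adjoin ℤ E,
    Subalgebra.fg_iff_finiteType _ |>.1 (Subalgebra.fg_def.2 ⟨E, hE, rfl⟩), ?_⟩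
  rw [MonoidHom.range_eq_map, ← hS, MonoidHom.map_closure, Subgroup.closure_le]
  rintro _ ⟨s, hs, rfl⟩
  refine mem_range_map_val (fun i j => Algebra.subset_adjoin ?_)
    (fun i j => Algebra.subset_adjoin ?_) <;>
  · simp only [E, Set.mem_iUnion]
    exact ⟨s, hs, i, j, by simp⟩

variable {K : Type*} [Field K] [CharZero K]

/-- **Selberg's lemma.** -/
theorem isVirtuallyTorsionFree_of_injective_GL {ρ : G →* GL n K} (hρ : Function.Injective ρ) :
    IsVirtuallyTorsionFree G := by
  obtain ⟨A, hA, hle⟩ := exists_finiteType_range_le_range_map ρ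
  set φ := GeneralLinearGroup.map (n := n) (A.val : A →+* K)
  have hφ : Function.Injective φ := Units.map_injective (Matrix.map_injective Subtype.val_injective)
  let ρA : G →* φ.range := ρ.codRestrict φ.range fun x => hle ⟨x, rfl⟩
  have hρA : Function.Injective ρA := (MonoidHom.injective_codRestrict ρ _ _).2 hρ
  have hφA : IsVirtuallyTorsionFree φ.range :=
    (isVirtuallyTorsionFree_GL_of_finiteType_int (A := A)).of_injective
      (f := (MonoidHom.ofInjective hφ).symm.toMonoidHom) (MulEquiv.injective _)
  exact hφA.of_injective hρA

theorem isVirtuallyTorsionFree_of_injective_end {V : Type*} [AddCommGroup V] [Module K V]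
    [FiniteDimensional K V] {ρ : G →* (Module.End K V)ˣ} (hρ : Function.Injective ρ) :
    IsVirtuallyTorsionFree G :=
  let e := Units.mapEquiv
    (LinearMap.toMatrixAlgEquiv (Module.finBasis K V)).toRingEquiv.toMulEquiv
  isVirtuallyTorsionFree_of_injective_GL (ρ := e.toMonoidHom.comp ρ) (e.injective.comp hρ)

end Selberg

section ProjectiveLinear

open Matrix
open scoped MatrixGroups

/-- The adjoint representation of `GL n R`, acting on all `n × n` matrices by conjugation. -/
def adjointRep (n R : Type*) [Fintype n] [DecidableEq n] [CommRing R] :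
    GL n R →* (Module.End R (Matrix n n R))ˣ :=
  ((DistribMulAction.toModuleEnd R (Matrix n n R)).comp
    (ConjAct.toConjAct (G := GL n R)).toMonoidHom).toHomUnits

theorem adjointRep_apply {n R : Type*} [Fintype n] [DecidableEq n] [CommRing R] (g : GL n R)
    (X : Matrix n n R) : (adjointRep n R g).val X = g.val * X * g⁻¹.val := rfl

theorem ker_adjointRep (n R : Type*) [Fintype n] [DecidableEq n] [CommRing R] :
    (adjointRep n R).ker = Subgroup.center (GL n R) := by
  ext g
  have hfix (X : Matrix n n R) : g.val * X * g⁻¹.val = X ↔ Commute X g.val := by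
    rw [Units.mul_inv_eq_iff_eq_mul]
    exact eq_comm
  have hone : adjointRep n R g = 1 ↔ ∀ X, Commute X g.val := by
    simp only [Units.ext_iff, LinearMap.ext_iff, adjointRep_apply, Units.val_one,
      Module.End.one_apply, hfix]
  rw [MonoidHom.mem_ker, hone, GeneralLinearGroup.mem_center_iff_val_mem_range_scalar]
  refine ⟨fun h => mem_range_scalar_iff_commute_single'.2 fun i j => h _, ?_⟩
  rintro ⟨a, ha⟩ X
  exact ha ▸ (scalar_commute a (Commute.all a) X).symm

/-- The faithful representation of `PGL n R` induced by the adjoint representation. -/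
def projAdjointRep (n R : Type*) [Fintype n] [DecidableEq n] [CommRing R] :
    ProjGenLinGroup n R →* (Module.End R (Matrix n n R))ˣ :=
  ProjGenLinGroup.lift (adjointRep n R) <| by
    rw [← MonoidHom.range_le_ker_iff, ker_adjointRep, GeneralLinearGroup.center_eq_range_scalar]

theorem projAdjointRep_injective (n R : Type*) [Fintype n] [DecidableEq n] [CommRing R] :
    Function.Injective (projAdjointRep n R) := by
  refine (injective_iff_map_eq_one _).2 fun x hx => ?_
  obtain ⟨g, rfl⟩ := ProjGenLinGroup.mk_surjective x
  rw [projAdjointRep, ProjGenLinGroup.lift_mk] at hx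
  rwa [ProjGenLinGroup.mk_eq_one, ← ker_adjointRep]

theorem isVirtuallyTorsionFree_of_injective_PGL {G n K : Type*} [Group G] [Group.FG G] [Fintype n]
    [DecidableEq n] [Field K] [CharZero K] {ρ : G →* ProjGenLinGroup n K}
    (hρ : Function.Injective ρ) : IsVirtuallyTorsionFree G :=
  isVirtuallyTorsionFree_of_injective_end (ρ := (projAdjointRep n K).comp ρ)
    ((projAdjointRep_injective n K).comp hρ)

end ProjectiveLinear

section Mobius

open Matrix
open scoped MatrixGroups

variable {K : Type*} [Field K] [DecidableEq K]

theorem smul_coe_eq_self_iff_isRoot {g : GL (Fin 2) K} {c : K} :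
    g • (c : OnePoint K) = c ↔ g.fixpointPolynomial.IsRoot c := by
  rw [← GeneralLinearGroup.fixpointPolynomial_aeval_eq_zero_iff, Polynomial.coe_aeval_eq_eval,
    Polynomial.IsRoot]

theorem smul_eq_self_of_mem_center {g : GL (Fin 2) K} (hg : g ∈ Subgroup.center (GL (Fin 2) K))
    (x : OnePoint K) : g • x = x := by
  rw [GeneralLinearGroup.mem_center_iff_val_mem_range_scalar] at hg
  induction x using OnePoint.rec with
  | infty =>
    obtain ⟨a, ha⟩ := hg
    simp [OnePoint.smul_infty_eq_self_iff, ← ha]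
  | coe c =>
    rw [smul_coe_eq_self_iff_isRoot, GeneralLinearGroup.fixpointPolynomial_eq_zero_iff.2 hg]
    exact Polynomial.eval_zero

theorem mem_center_of_infinite_fixedBy {g : GL (Fin 2) K}
    (hg : (MulAction.fixedBy (OnePoint K) g).Infinite) : g ∈ Subgroup.center (GL (Fin 2) K) := by
  rw [GeneralLinearGroup.mem_center_iff_val_mem_range_scalar,
    ← GeneralLinearGroup.fixpointPolynomial_eq_zero_iff]
  by_contra hne
  have hroots := (Polynomial.finite_setOfPred_isRoot hne).image ((↑) : K → OnePoint K)
  refine hg ((hroots.insert OnePoint.infty).subset fun x hx => ?_)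
  induction x using OnePoint.rec with
  | infty => exact Set.mem_insert _ _
  | coe c => exact Or.inr ⟨c, smul_coe_eq_self_iff_isRoot.1 hx, rfl⟩

theorem mk_eq_mk_iff_eqOn_smul {s : Set (OnePoint K)} (hs : s.Infinite) {g h : GL (Fin 2) K} :
    ProjGenLinGroup.mk g = ProjGenLinGroup.mk h ↔ ∀ x ∈ s, g • x = h • x := by
  have hmk : ProjGenLinGroup.mk g = ProjGenLinGroup.mk h ↔
      h⁻¹ * g ∈ Subgroup.center (GL (Fin 2) K) := by
    rw [← ProjGenLinGroup.mk_eq_one, map_mul, map_inv, inv_mul_eq_one, eq_comm]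
  have hfix (x : OnePoint K) : (h⁻¹ * g) • x = x ↔ g • x = h • x := by
    rw [mul_smul, inv_smul_eq_iff]
  simp only [hmk, ← hfix]
  exact ⟨fun hc x _ => smul_eq_self_of_mem_center hc x,
    fun hx => mem_center_of_infinite_fixedBy (hs.mono hx)⟩

theorem exists_injective_PGL_of_forall_eq_smul {X : Type*} [Infinite X] {ι : X → OnePoint K}
    (hι : Function.Injective ι) {Γ : Subgroup (Equiv.Perm X)}
    (hΓ : ∀ f ∈ Γ, ∃ g : GL (Fin 2) K, ∀ x, ι (f x) = g • ι x) :
    ∃ ρ : Γ →* ProjGenLinGroup (Fin 2) K, Function.Injective ρ := by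
  choose! M hM using hΓ
  have hs : (Set.range ι).Infinite := Set.infinite_range_of_injective hι
  refine ⟨MonoidHom.mk' (fun f => ProjGenLinGroup.mk (M f)) fun f g => ?_, fun f g hfg => ?_⟩
  · rw [← map_mul, mk_eq_mk_iff_eqOn_smul hs]
    rintro _ ⟨x, rfl⟩
    rw [← hM _ (f * g).2, mul_smul, ← hM _ g.2, ← hM _ f.2]
    rfl
  · ext x
    have h := (mk_eq_mk_iff_eqOn_smul hs).1 hfg (ι x) ⟨x, rfl⟩
    rw [← hM _ f.2, ← hM _ g.2] at h
    exact hι h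

end Mobius

section ComplexPlane

open Asymptotics Bornology

theorem exists_eq_mul_add_of_isBigO_id {f : ℂ → ℂ} (hf : Differentiable ℂ f)
    (hO : f =O[cobounded ℂ] id) : ∃ a, ∀ z, f z = a * z + f 0 := by
  have hd : Differentiable ℂ (dslope f 0) := by
    rw [← differentiableOn_univ, Complex.differentiableOn_dslope univ_mem]
    exact hf.differentiableOn
  have hne : ∀ᶠ z : ℂ in cobounded ℂ, z ≠ 0 := eventually_ne_cobounded 0
  have hsub : (fun z => f z - f 0) =O[cobounded ℂ] id :=
    hO.sub (isLittleO_const_id_cobounded _).isBigO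
  have hslope : dslope f 0 =O[cobounded ℂ] (1 : ℂ → ℝ) := by
    refine ((isBigO_refl (fun z : ℂ => z⁻¹) _).mul hsub).congr' ?_ ?_ |>.trans
      (isBigO_const_const (1 : ℂ) one_ne_zero _)
    · filter_upwards [hne] with z hz
      rw [dslope_of_ne _ hz, slope_def_field, sub_zero, div_eq_inv_mul]
    · filter_upwards [hne] with z hz using inv_mul_cancel₀ hz
  rw [Metric.cobounded_eq_cocompact] at hslope
  obtain ⟨a, ha⟩ := hd.exists_const_forall_eq_of_bounded
    (hd.continuous.isBounded_range_iff_isBigO.2 hslope)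
  refine ⟨a, fun z => ?_⟩
  have h : z * dslope f 0 z = f z - f 0 := by simpa using sub_smul_dslope f 0 z
  rw [← sub_eq_iff_eq_add, ← h, ha, mul_comm]

-- `w ↦ 1 / g (1 / w)` has a removable singularity with value `0` at `0`, hence is `O(w)` there.
theorem isBigO_id_cobounded_of_leftInverse {f g : ℂ → ℂ} (hg : Differentiable ℂ g)
    (hgf : Function.LeftInverse g f) (hf_tendsto : Tendsto f (cobounded ℂ) (cobounded ℂ))
    (hg_tendsto : Tendsto g (cobounded ℂ) (cobounded ℂ)) : f =O[cobounded ℂ] id := by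
  set k : ℂ → ℂ := fun w => (g w⁻¹)⁻¹
  have hginv : Tendsto (fun w => g w⁻¹) (𝓝[≠] 0) (cobounded ℂ) :=
    hg_tendsto.comp tendsto_inv₀_nhdsNE_zero
  have hk_diff : ∀ᶠ w in 𝓝[≠] (0 : ℂ), DifferentiableAt ℂ (Function.update k 0 0) w := by
    filter_upwards [self_mem_nhdsWithin, hginv.eventually (eventually_ne_cobounded 0)] with w hw hgw
    refine ((hg.differentiableAt.comp w (differentiableAt_inv hw)).inv hgw).congr_of_eventuallyEq ?_
    exact (eventually_ne_nhds hw).mono fun v hv => Function.update_of_ne hv 0 k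
  have hk_cont : ContinuousAt (Function.update k 0 0) 0 :=
    continuousAt_update_same.2 (tendsto_inv₀_cobounded.comp hginv)
  have hk : k =O[𝓝[≠] 0] id := by
    have h := (Complex.analyticAt_of_differentiable_on_punctured_nhds_of_continuousAt
      hk_diff hk_cont).differentiableAt.isBigO_sub.mono (nhdsWithin_le_nhds (s := {0}ᶜ))
    refine h.congr' ?_ (.of_forall fun w => sub_zero w)
    filter_upwards [self_mem_nhdsWithin] with w hw
    rw [Function.update_self, sub_zero, Function.update_of_ne hw]
  have hinv : (fun z : ℂ => z⁻¹) =O[cobounded ℂ] fun z => (f z)⁻¹ := by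
    refine (hk.comp_tendsto (tendsto_inv₀_cobounded'.comp hf_tendsto)).congr_left fun z => ?_
    simp only [k, Function.comp_apply, inv_inv, hgf z]
  refine (hinv.inv_rev ?_).congr (fun z => inv_inv (f z)) fun z => inv_inv z
  exact (eventually_ne_cobounded 0).mono fun z hz h => absurd (inv_eq_zero.1 h) hz

theorem exists_eq_mul_add_of_mem_holomorphicAut {f : Equiv.Perm ℂ} (hf : f ∈ holomorphicAut ℂ) :
    ∃ a b : ℂ, a ≠ 0 ∧ ∀ z, f z = a * z + b := by
  have hd : Differentiable ℂ f := hf.1.differentiable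
  have hd' : Differentiable ℂ f.symm := hf.2.differentiable
  let e : ℂ ≃ₜ ℂ := ⟨f, hd.continuous, hd'.continuous⟩
  have he (e : ℂ ≃ₜ ℂ) : Tendsto e (cobounded ℂ) (cobounded ℂ) := by
    rw [Metric.cobounded_eq_cocompact]
    exact e.map_cocompact.le
  obtain ⟨a, ha⟩ := exists_eq_mul_add_of_isBigO_id hd
    (isBigO_id_cobounded_of_leftInverse hd' f.symm_apply_apply (he e) (he e.symm))
  refine ⟨a, f 0, ?_, ha⟩
  rintro rfl
  exact one_ne_zero (f.injective (by rw [ha 1, zero_mul, zero_add]))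

end ComplexPlane

section MobiusFormula

open Matrix
open scoped MatrixGroups

theorem mkOfDetNeZero_smul_coe {K : Type*} [Field K] [DecidableEq K] {a b c d z : K}
    (hdet : (!![a, b; c, d]).det ≠ 0) (hz : c * z + d ≠ 0) :
    GeneralLinearGroup.mkOfDetNeZero !![a, b; c, d] hdet • (z : OnePoint K) =
      ((a * z + b) / (c * z + d) : K) := by
  simp [OnePoint.smul_some_eq_ite, GeneralLinearGroup.mkOfDetNeZero, hz]

theorem exists_affine_smul_coe {K : Type*} [Field K] [DecidableEq K] {a : K} (ha : a ≠ 0) (b : K) :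
    ∃ g : GL (Fin 2) K, g • OnePoint.infty = (OnePoint.infty : OnePoint K) ∧
      ∀ z : K, g • (z : OnePoint K) = (a * z + b : K) := by
  refine ⟨GeneralLinearGroup.mkOfDetNeZero !![a, b; 0, 1] (by simpa using ha), ?_, fun z => ?_⟩
  · rw [OnePoint.smul_infty_eq_self_iff]
    rfl
  · rw [mkOfDetNeZero_smul_coe _ (by simp)]
    simp

theorem exists_smul_eq_infty {K : Type*} [Field K] [DecidableEq K] (x : OnePoint K) :
    ∃ g : GL (Fin 2) K, g • x = OnePoint.infty := by
  induction x using OnePoint.rec with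
  | infty => exact ⟨1, one_smul _ _⟩
  | coe p =>
    refine ⟨GeneralLinearGroup.mkOfDetNeZero !![0, 1; 1, -p] (by simp), ?_⟩
    simp [OnePoint.smul_some_eq_ite, GeneralLinearGroup.mkOfDetNeZero]

end MobiusFormula

section UnitDisc

open Metric Set

theorem exists_eqOn_ball_mul_of_leftInvOn {g h : ℂ → ℂ} (hg : DifferentiableOn ℂ g (ball 0 1))
    (hh : DifferentiableOn ℂ h (ball 0 1)) (hg_maps : MapsTo g (ball 0 1) (ball 0 1))
    (hh_maps : MapsTo h (ball 0 1) (ball 0 1)) (hg_zero : g 0 = 0) (hh_zero : h 0 = 0)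
    (hinv : LeftInvOn h g (ball 0 1)) : ∃ C : ℂ, C ≠ 0 ∧ EqOn g (C * ·) (ball 0 1) := by
  have hg_maps' := hg_maps.mono_right ball_subset_closedBall
  have hh_maps' := hh_maps.mono_right ball_subset_closedBall
  have hhalf : ‖(1 / 2 : ℂ)‖ < 1 := by norm_num
  have hhalf' : (1 / 2 : ℂ) ∈ ball 0 1 := mem_ball_zero_iff.2 hhalf
  -- The Schwarz lemma for `g` and for `h` makes both inequalities for `‖g z‖` equalities.
  have hnorm : ‖g (1 / 2)‖ = ‖(1 / 2 : ℂ)‖ := by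
    refine (Complex.norm_le_norm_of_mapsTo_ball hg hg_maps' hg_zero hhalf).antisymm ?_
    conv_lhs => rw [← hinv hhalf']
    exact Complex.norm_le_norm_of_mapsTo_ball hh hh_maps' hh_zero
      (mem_ball_zero_iff.1 (hg_maps hhalf'))
  have hslope : ‖dslope g 0 (1 / 2)‖ = 1 / 1 := by
    rw [dslope_of_ne _ (by norm_num), slope_def_field, hg_zero, sub_zero, sub_zero, norm_div, hnorm]
    norm_num
  obtain ⟨C, hC, hgC⟩ := Complex.affine_of_mapsTo_ball_of_exists_norm_dslope_eq_div' hg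
    (by rwa [hg_zero]) ⟨1 / 2, hhalf', hslope⟩
  refine ⟨C, norm_pos_iff.1 (by rw [hC]; norm_num), fun z hz => ?_⟩
  simpa [hg_zero, mul_comm] using hgC hz

end UnitDisc

section UpperHalfPlane

open Matrix Metric Set UpperHalfPlane
open scoped MatrixGroups ComplexConjugate

/-- The Cayley transform `z ↦ (z - p) / (z - p̄)` centred at `p`, which maps the upper half-plane
onto the unit disc and `p` to `0`. -/
noncomputable def cayley (p : ℍ) (z : ℂ) : ℂ := (z - p) / (z - conj (p : ℂ))

/-- The inverse of the Cayley transform centred at `p`. -/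
noncomputable def cayleySymm (p : ℍ) (ζ : ℂ) : ℂ := (p - conj (p : ℂ) * ζ) / (1 - ζ)

theorem coe_sub_conj_ne_zero (p z : ℍ) : (z : ℂ) - conj (p : ℂ) ≠ 0 := by
  intro h
  have him : z.im + p.im = 0 := by simpa using congrArg Complex.im h
  exact (add_pos z.im_pos p.im_pos).ne' him

theorem one_sub_ne_zero_of_mem_ball {ζ : ℂ} (hζ : ζ ∈ ball (0 : ℂ) 1) : 1 - ζ ≠ 0 := by
  rintro h
  simp [← sub_eq_zero.1 h] at hζ

theorem cayley_mem_ball (p z : ℍ) : cayley p z ∈ ball (0 : ℂ) 1 := by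
  rw [mem_ball_zero_iff, cayley, norm_div, ← dist_eq_norm, ← dist_eq_norm, ← tanh_half_dist]
  exact Real.tanh_lt_one _

theorem cayleySymm_im_pos (p : ℍ) {ζ : ℂ} (hζ : ζ ∈ ball (0 : ℂ) 1) : 0 < (cayleySymm p ζ).im := by
  have hden : 0 < Complex.normSq (1 - ζ) := Complex.normSq_pos.2 (one_sub_ne_zero_of_mem_ball hζ)
  have hnorm : Complex.normSq ζ < 1 := by
    rw [Complex.normSq_eq_norm_sq]
    exact pow_lt_one₀ (norm_nonneg _) (mem_ball_zero_iff.1 hζ) two_ne_zero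
  have him : (cayleySymm p ζ).im = p.im * (1 - Complex.normSq ζ) / Complex.normSq (1 - ζ) := by
    rw [cayleySymm, Complex.div_im, ← sub_div, Complex.normSq_apply ζ]
    congr 1
    simp only [Complex.sub_re, Complex.sub_im, Complex.mul_re, Complex.mul_im, Complex.conj_re,
      Complex.conj_im, Complex.one_re, Complex.one_im, coe_im, coe_re]
    ring
  rw [him]
  exact div_pos (mul_pos p.im_pos (sub_pos.2 hnorm)) hden

theorem cayley_cayleySymm (p : ℍ) {ζ : ℂ} (hζ : ζ ∈ ball (0 : ℂ) 1) :
    cayley p (cayleySymm p ζ) = ζ := by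
  have h1 := one_sub_ne_zero_of_mem_ball hζ
  have h2 : cayleySymm p ζ - conj (p : ℂ) ≠ 0 :=
    coe_sub_conj_ne_zero p ⟨cayleySymm p ζ, cayleySymm_im_pos p hζ⟩
  rw [cayley, div_eq_iff h2]
  simp only [cayleySymm]
  field_simp
  ring

theorem cayleySymm_cayley (p z : ℍ) : cayleySymm p (cayley p z) = z := by
  have h1 := one_sub_ne_zero_of_mem_ball (cayley_mem_ball p z)
  have h2 := coe_sub_conj_ne_zero p z
  rw [cayleySymm, div_eq_iff h1, cayley]
  field_simp
  ring

/-- The self-map of the unit disc fixing `0` which corresponds to `f` under the Cayley transforms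
centred at `p` and `f p`. -/
noncomputable def discConj (f : ℍ → ℍ) (p : ℍ) (ζ : ℂ) : ℂ :=
  cayley (f p) (f (ofComplex (cayleySymm p ζ)))

theorem discConj_cayley (f : ℍ → ℍ) (p z : ℍ) : discConj f p (cayley p z) = cayley (f p) (f z) := by
  rw [discConj, cayleySymm_cayley, ofComplex_apply]

theorem discConj_zero (f : ℍ → ℍ) (p : ℍ) : discConj f p 0 = 0 := by
  have hself (q : ℍ) : cayley q q = 0 := by rw [cayley, sub_self, zero_div]
  simpa only [hself] using discConj_cayley f p p

theorem mapsTo_discConj (f : ℍ → ℍ) (p : ℍ) : MapsTo (discConj f p) (ball 0 1) (ball 0 1) :=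
  fun _ _ => cayley_mem_ball _ _

theorem leftInvOn_discConj (f : Equiv.Perm ℍ) (p : ℍ) :
    LeftInvOn (discConj f.symm (f p)) (discConj f p) (ball 0 1) := by
  intro ζ hζ
  have hconj : discConj f p ζ = cayley (f p) (f (ofComplex (cayleySymm p ζ))) := rfl
  rw [hconj, discConj_cayley, f.symm_apply_apply, f.symm_apply_apply,
    ofComplex_apply_of_im_pos (cayleySymm_im_pos p hζ)]
  exact cayley_cayleySymm p hζ

theorem differentiableOn_discConj {f : ℍ → ℍ} (hf : MDifferentiable 𝓘(ℂ) 𝓘(ℂ) f) (p : ℍ) :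
    DifferentiableOn ℂ (discConj f p) (ball 0 1) := by
  have hsymm : DifferentiableOn ℂ (cayleySymm p) (ball 0 1) :=
    DifferentiableOn.div (by fun_prop) (by fun_prop) fun ζ hζ => one_sub_ne_zero_of_mem_ball hζ
  have hcomp : DifferentiableOn ℂ (fun ζ => (f (ofComplex (cayleySymm p ζ)) : ℂ)) (ball 0 1) :=
    (UpperHalfPlane.mdifferentiable_iff.1 (mdifferentiable_coe.comp hf)).comp hsymm
      fun ζ hζ => cayleySymm_im_pos p hζ
  exact (hcomp.sub_const _).div (hcomp.sub_const _) fun ζ _ => coe_sub_conj_ne_zero _ _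

theorem exists_cayley_apply_eq_mul {f : Equiv.Perm ℍ} (hf : f ∈ holomorphicAut ℍ) (p : ℍ) :
    ∃ C : ℂ, C ≠ 0 ∧ ∀ z : ℍ, cayley (f p) (f z) = C * cayley p z := by
  have hzero : discConj f.symm (f p) 0 = 0 := discConj_zero _ _
  obtain ⟨C, hC, h⟩ := exists_eqOn_ball_mul_of_leftInvOn (differentiableOn_discConj hf.1 p)
    (differentiableOn_discConj hf.2 (f p)) (mapsTo_discConj f p) (mapsTo_discConj f.symm (f p))
    (discConj_zero f p) hzero (leftInvOn_discConj f p)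
  exact ⟨C, hC, fun z => by rw [← discConj_cayley, h (cayley_mem_ball p z)]⟩

theorem exists_smul_coe_eq_cayley (p : ℍ) :
    ∃ g : GL (Fin 2) ℂ, ∀ z : ℍ, g • ((z : ℂ) : OnePoint ℂ) = cayley p z := by
  have hdet : (!![1, -(p : ℂ); 1, -conj (p : ℂ)]).det ≠ 0 := by
    rw [det_fin_two_of, one_mul, mul_one, neg_sub_neg]
    exact coe_sub_conj_ne_zero p p
  refine ⟨GeneralLinearGroup.mkOfDetNeZero _ hdet, fun z => ?_⟩
  have hz : 1 * (z : ℂ) + -conj (p : ℂ) ≠ 0 := by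
    simpa only [one_mul, ← sub_eq_add_neg] using coe_sub_conj_ne_zero p z
  rw [mkOfDetNeZero_smul_coe hdet hz, cayley, one_mul, ← sub_eq_add_neg, ← sub_eq_add_neg]

theorem exists_eq_smul_of_mem_holomorphicAut_upperHalfPlane {f : Equiv.Perm ℍ}
    (hf : f ∈ holomorphicAut ℍ) :
    ∃ g : GL (Fin 2) ℂ, ∀ z : ℍ, ((f z : ℂ) : OnePoint ℂ) = g • ((z : ℂ) : OnePoint ℂ) := by
  obtain ⟨C, hC, h⟩ := exists_cayley_apply_eq_mul hf I
  obtain ⟨g₁, hg₁⟩ := exists_smul_coe_eq_cayley I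
  obtain ⟨g₂, hg₂⟩ := exists_smul_coe_eq_cayley (f I)
  obtain ⟨r, -, hr⟩ := exists_affine_smul_coe hC 0
  refine ⟨g₂⁻¹ * r * g₁, fun z => ?_⟩
  rw [mul_smul, mul_smul, hg₁, hr, add_zero, ← h, ← hg₂, inv_smul_smul]

end UpperHalfPlane

section Sphere

open Matrix RiemannSphere
open scoped MatrixGroups

theorem chartZero_coe (z : ℂ) : chartZero (z : OnePoint ℂ) = z :=
  chartZero.right_inv (x := z) trivial

theorem coe_chartZero {x : OnePoint ℂ} (hx : x ≠ OnePoint.infty) :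
    (chartZero x : OnePoint ℂ) = x := by
  obtain ⟨z, rfl⟩ := OnePoint.ne_infty_iff_exists.1 hx
  rw [chartZero_coe]

theorem chartZero_mem_atlas : chartZero ∈ atlas ℂ (OnePoint ℂ) := Set.mem_insert _ _

theorem chartInfty_mem_atlas : chartInfty ∈ atlas ℂ (OnePoint ℂ) := Set.mem_insert_of_mem _ rfl

theorem mdifferentiable_onePoint_coe : MDifferentiable 𝓘(ℂ) 𝓘(ℂ) ((↑) : ℂ → OnePoint ℂ) :=
  fun _ => mdifferentiableAt_atlas_symm chartZero_mem_atlas trivial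

theorem mdifferentiableAt_chartZero {x : OnePoint ℂ} (hx : x ≠ OnePoint.infty) :
    MDifferentiableAt 𝓘(ℂ) 𝓘(ℂ) chartZero x := by
  obtain ⟨z, rfl⟩ := OnePoint.ne_infty_iff_exists.1 hx
  exact mdifferentiableAt_atlas chartZero_mem_atlas (mem_chartZero_source z)

theorem mdifferentiableAt_coe_iff {f : OnePoint ℂ → OnePoint ℂ} {z : ℂ} :
    MDifferentiableAt 𝓘(ℂ) 𝓘(ℂ) f z ↔ MDifferentiableAt 𝓘(ℂ) 𝓘(ℂ) (fun w : ℂ => f w) z := by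
  refine ⟨fun h => h.comp z (mdifferentiable_onePoint_coe z), fun h => ?_⟩
  rw [← chartZero_coe z] at h
  refine (h.comp _ (mdifferentiableAt_chartZero (OnePoint.coe_ne_infty z))).congr_of_eventuallyEq ?_
  filter_upwards [isOpen_ne.mem_nhds (OnePoint.coe_ne_infty z)] with x hx
  rw [Function.comp_apply, coe_chartZero hx]

theorem mdifferentiable_inversion : MDifferentiable 𝓘(ℂ) 𝓘(ℂ) inversion := by
  intro x
  induction x using OnePoint.rec with
  | infty =>
    have h : ∀ᶠ x in 𝓝 OnePoint.infty, inversion x ≠ OnePoint.infty :=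
      continuous_inversion.continuousAt.eventually_ne
        (by rw [inversion_infty]; exact OnePoint.coe_ne_infty 0)
    refine ((mdifferentiable_onePoint_coe _).comp _ (mdifferentiableAt_atlas chartInfty_mem_atlas
      infty_mem_chartInfty_source)).congr_of_eventuallyEq (h.mono fun x hx => ?_)
    exact (coe_chartZero hx).symm
  | coe z =>
    have h : MDifferentiableAt 𝓘(ℂ) 𝓘(ℂ) chartInfty.symm z :=
      mdifferentiableAt_atlas_symm chartInfty_mem_atlas ⟨trivial, trivial⟩
    exact mdifferentiableAt_coe_iff.2 h

theorem exists_smul_eq_inversion : ∃ S : GL (Fin 2) ℂ, ∀ x, S • x = inversion x := by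
  have hdet : (!![(0 : ℂ), 1; 1, 0]).det ≠ 0 := by simp
  refine ⟨GeneralLinearGroup.mkOfDetNeZero _ hdet, fun x => ?_⟩
  induction x using OnePoint.rec with
  | infty => simp [OnePoint.smul_infty_def, GeneralLinearGroup.mkOfDetNeZero, inversion_infty]
  | coe z =>
    by_cases hz : z = 0
    · subst hz
      simp [OnePoint.smul_some_eq_ite, GeneralLinearGroup.mkOfDetNeZero, inversion_zero]
    · rw [mkOfDetNeZero_smul_coe hdet (by simpa using hz), inversion_coe hz]
      simp

theorem mdifferentiableAt_onePoint_smul_coe {g : GL (Fin 2) ℂ} {z : ℂ}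
    (hz : g • (z : OnePoint ℂ) ≠ OnePoint.infty) :
    MDifferentiableAt 𝓘(ℂ) 𝓘(ℂ) (g • · : OnePoint ℂ → OnePoint ℂ) z := by
  have hden : g 1 0 * z + g 1 1 ≠ 0 := by
    intro h
    exact hz (by rw [OnePoint.smul_some_eq_ite, if_pos h])
  have hnear : ∀ᶠ w in 𝓝 z, g 1 0 * w + g 1 1 ≠ 0 :=
    ContinuousAt.eventually_ne (by fun_prop) hden
  have hdiff : DifferentiableAt ℂ (fun w => (g 0 0 * w + g 0 1) / (g 1 0 * w + g 1 1)) z :=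
    DifferentiableAt.div (by fun_prop) (by fun_prop) hden
  rw [mdifferentiableAt_coe_iff]
  refine ((mdifferentiable_onePoint_coe _).comp z hdiff.mdifferentiableAt).congr_of_eventuallyEq
    (hnear.mono fun w hw => ?_)
  exact OnePoint.smul_some_eq_ite.trans (if_neg hw)

theorem mdifferentiable_onePoint_smul (g : GL (Fin 2) ℂ) :
    MDifferentiable 𝓘(ℂ) 𝓘(ℂ) (g • · : OnePoint ℂ → OnePoint ℂ) := by
  obtain ⟨S, hS⟩ := exists_smul_eq_inversion
  have hcoe (g : GL (Fin 2) ℂ) (z : ℂ) :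
      MDifferentiableAt 𝓘(ℂ) 𝓘(ℂ) (g • · : OnePoint ℂ → OnePoint ℂ) z := by
    by_cases hz : g • (z : OnePoint ℂ) = OnePoint.infty
    · have hg : (g • · : OnePoint ℂ → OnePoint ℂ) = inversion ∘ ((S * g) • ·) := by
        funext x
        rw [Function.comp_apply, mul_smul, hS, inversion_inversion]
      rw [hg]
      refine (mdifferentiable_inversion _).comp _ (mdifferentiableAt_onePoint_smul_coe ?_)
      rw [mul_smul, hz, hS, inversion_infty]
      exact OnePoint.coe_ne_infty 0
    · exact mdifferentiableAt_onePoint_smul_coe hz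
  intro x
  induction x using OnePoint.rec with
  | infty =>
    have hg : (g • · : OnePoint ℂ → OnePoint ℂ) = ((g * S) • ·) ∘ inversion := by
      funext x
      rw [Function.comp_apply, mul_smul, hS, inversion_inversion]
    rw [hg]
    exact (hcoe (g * S) 0).comp OnePoint.infty (mdifferentiable_inversion _)
  | coe z => exact hcoe g z

theorem toPerm_mem_holomorphicAut (g : GL (Fin 2) ℂ) :
    MulAction.toPerm g ∈ holomorphicAut (OnePoint ℂ) :=
  ⟨mdifferentiable_onePoint_smul g, mdifferentiable_onePoint_smul g⁻¹⟩

theorem mdifferentiable_chartZero_comp {f : OnePoint ℂ → OnePoint ℂ}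
    (hf : MDifferentiable 𝓘(ℂ) 𝓘(ℂ) f) (h : ∀ z : ℂ, f z ≠ OnePoint.infty) :
    MDifferentiable 𝓘(ℂ) 𝓘(ℂ) fun z : ℂ => chartZero (f z) := fun z =>
  (mdifferentiableAt_chartZero (h z)).comp z (mdifferentiableAt_coe_iff.1 (hf z))

theorem exists_mem_holomorphicAut_of_apply_infty {f : Equiv.Perm (OnePoint ℂ)}
    (hf : f ∈ holomorphicAut (OnePoint ℂ)) (hinf : f OnePoint.infty = OnePoint.infty) :
    ∃ h ∈ holomorphicAut ℂ, ∀ z : ℂ, f z = (h z : OnePoint ℂ) := by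
  have hne (z : ℂ) : f z ≠ OnePoint.infty := fun h =>
    OnePoint.coe_ne_infty z (f.injective (h.trans hinf.symm))
  have hne' (z : ℂ) : f.symm z ≠ OnePoint.infty := fun h =>
    OnePoint.coe_ne_infty z ((f.symm_apply_eq.1 h).trans hinf)
  let h : Equiv.Perm ℂ :=
    { toFun z := chartZero (f z)
      invFun z := chartZero (f.symm z)
      left_inv z := by
        beta_reduce
        rw [coe_chartZero (hne z), f.symm_apply_apply, chartZero_coe]
      right_inv z := by
        beta_reduce
        rw [coe_chartZero (hne' z), f.apply_symm_apply, chartZero_coe] }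
  exact ⟨h, ⟨mdifferentiable_chartZero_comp hf.1 hne, mdifferentiable_chartZero_comp hf.2 hne'⟩,
    fun z => (coe_chartZero (hne z)).symm⟩

theorem exists_eq_smul_of_mem_holomorphicAut_complex {f : Equiv.Perm ℂ}
    (hf : f ∈ holomorphicAut ℂ) :
    ∃ g : GL (Fin 2) ℂ, g • OnePoint.infty = (OnePoint.infty : OnePoint ℂ) ∧
      ∀ z : ℂ, (f z : OnePoint ℂ) = g • (z : OnePoint ℂ) := by
  obtain ⟨a, b, ha, hab⟩ := exists_eq_mul_add_of_mem_holomorphicAut hf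
  obtain ⟨g, hinf, hg⟩ := exists_affine_smul_coe ha b
  exact ⟨g, hinf, fun z => by rw [hab, hg]⟩

theorem exists_eq_smul_of_mem_holomorphicAut_onePoint {f : Equiv.Perm (OnePoint ℂ)}
    (hf : f ∈ holomorphicAut (OnePoint ℂ)) :
    ∃ g : GL (Fin 2) ℂ, ∀ x, f x = g • x := by
  obtain ⟨g₁, hg₁⟩ := exists_smul_eq_infty (f OnePoint.infty)
  obtain ⟨h, hh, hfh⟩ := exists_mem_holomorphicAut_of_apply_infty
    (mul_mem (toPerm_mem_holomorphicAut g₁) hf) hg₁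
  obtain ⟨g₂, hinf, hg₂⟩ := exists_eq_smul_of_mem_holomorphicAut_complex hh
  refine ⟨g₁⁻¹ * g₂, fun x => ?_⟩
  rw [mul_smul, eq_inv_smul_iff]
  induction x using OnePoint.rec with
  | infty => rw [hg₁, hinf]
  | coe z => exact (hfh z).trans (hg₂ z)

end Sphere

section Fuchsian

variable {X : Type*} [TopologicalSpace X] [ChartedSpace ℂ X] {Γ : Subgroup (Equiv.Perm X)}
  {G : Type*} [Group G]

theorem IsCocompactDiscontinuous.fg_of_mulEquiv (hΓ : IsCocompactDiscontinuous Γ) (e : G ≃* Γ) :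
    Group.FG G := by
  have := (Group.fg_iff_subgroup_fg Γ).2 hΓ.fg
  exact Group.fg_of_surjective (f := e.symm.toMonoidHom) e.symm.surjective

theorem IsCocompactDiscontinuous.exists_injective_of_mulEquiv (hΓ : IsCocompactDiscontinuous Γ)
    (e : G ≃* Γ) : ∃ φ : G →* holomorphicAut X, Function.Injective φ :=
  ⟨(Subgroup.inclusion hΓ.le_aut).comp e.toMonoidHom,
    (Subgroup.inclusion_injective hΓ.le_aut).comp e.injective⟩

theorem IsFuchsianGroup.fg (hG : IsFuchsianGroup G) : Group.FG G := by
  rcases hG with ⟨_, hΓ, ⟨e⟩⟩ | ⟨_, hΓ, ⟨e⟩⟩ | ⟨_, hΓ, ⟨e⟩⟩ <;> exact hΓ.fg_of_mulEquiv e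

end Fuchsian

section Embedding

open Matrix
open scoped MatrixGroups

theorem exists_injective_PGL_holomorphicAut_onePoint :
    ∃ ρ : holomorphicAut (OnePoint ℂ) →* ProjGenLinGroup (Fin 2) ℂ, Function.Injective ρ :=
  exists_injective_PGL_of_forall_eq_smul Function.injective_id fun _ hf =>
    exists_eq_smul_of_mem_holomorphicAut_onePoint hf

theorem exists_injective_PGL_holomorphicAut_complex :
    ∃ ρ : holomorphicAut ℂ →* ProjGenLinGroup (Fin 2) ℂ, Function.Injective ρ :=
  exists_injective_PGL_of_forall_eq_smul OnePoint.coe_injective fun _ hf =>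
    (exists_eq_smul_of_mem_holomorphicAut_complex hf).imp fun _ => And.right

theorem exists_injective_PGL_holomorphicAut_upperHalfPlane :
    ∃ ρ : holomorphicAut UpperHalfPlane →* ProjGenLinGroup (Fin 2) ℂ, Function.Injective ρ :=
  exists_injective_PGL_of_forall_eq_smul
    (OnePoint.coe_injective.comp UpperHalfPlane.coe_injective) fun _ hf =>
    exists_eq_smul_of_mem_holomorphicAut_upperHalfPlane hf

end Embedding

theorem proposition3_general (G : Type*) [Group G] [Group.FG G]
    (hG : (∃ φ : G →* holomorphicAut (OnePoint ℂ), Function.Injective φ) ∨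
      (∃ φ : G →* holomorphicAut ℂ, Function.Injective φ) ∨
      (∃ φ : G →* holomorphicAut UpperHalfPlane, Function.Injective φ)) :
    ∃ N : Subgroup G, N.Normal ∧ N.FiniteIndex ∧ IsTorsionFreeSubgroup N := by
  rcases hG with ⟨φ, hφ⟩ | ⟨φ, hφ⟩ | ⟨φ, hφ⟩
  · obtain ⟨ρ, hρ⟩ := exists_injective_PGL_holomorphicAut_onePoint
    exact isVirtuallyTorsionFree_of_injective_PGL (ρ := ρ.comp φ) (hρ.comp hφ)
  · obtain ⟨ρ, hρ⟩ := exists_injective_PGL_holomorphicAut_complex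
    exact isVirtuallyTorsionFree_of_injective_PGL (ρ := ρ.comp φ) (hρ.comp hφ)
  · obtain ⟨ρ, hρ⟩ := exists_injective_PGL_holomorphicAut_upperHalfPlane
    exact isVirtuallyTorsionFree_of_injective_PGL (ρ := ρ.comp φ) (hρ.comp hφ)

theorem proposition3 (G : Type*) [Group G] (hG : IsFuchsianGroup G) :
    ∃ N : Subgroup G, N.Normal ∧ N.FiniteIndex ∧ IsTorsionFreeSubgroup N := by
  have := hG.fg
  exact proposition3_general G <|
    hG.imp (fun ⟨_, hΓ, ⟨e⟩⟩ => hΓ.exists_injective_of_mulEquiv e) <|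
      Or.imp (fun ⟨_, hΓ, ⟨e⟩⟩ => hΓ.exists_injective_of_mulEquiv e)
        fun ⟨_, hΓ, ⟨e⟩⟩ => hΓ.exists_injective_of_mulEquiv e
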